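/- Let $n\ge 3$, let $A=(a_{ij})_{1\le i,j\le n}$ be a real $n\times n$ matrix, and let $\pi$ be a random permutation with the uniform distribution on the symmetric group $S_n$. Put $Y=\sum_{i=1}^n a_{i\pi(i)}$ and $$a_{i\cdot}=\frac1n\sum_{j=1}^n a_{ij},\qquad a_{\cdot j}=\frac1n\sum_{i=1}^n a_{ij},\qquad a_{\cdot\cdot}=\frac1{n^2}\sum_{i,j=1}^n a_{ij},$$ $$\mu_A=n\,a_{\cdot\cdot},\qquad \sigma_A^2=\frac1{n-1}\sum_{i,j=1}^n\bigl(a_{ij}-a_{i\cdot}-a_{\cdot j}+a_{\cdot\cdot}\bigr)^2,\qquad c=8\max_{1\le i,j\le n}|a_{ij}-a_{i\cdot}|,$$ and assume $\sigma_A^2\neq 0$. Then $\mathbb E[Y]=\mu_A$, $\operatorname{Var}(Y)=\sigma_A^2>0$, $c>0$, and the following hold. (a) For all $t\ge 0$, each of $\mathbb P(Y-\mu_A\ge t)$ and $\mathbb P(Y-\mu_A\le -t)$ is at most $$\exp\left(-\frac{t^2}{2(\sigma_A^2+ct)}\right)$$ and also at most $$\exp\left(-\frac{t^2}{10\sigma_A^2/3+ct}\right).$$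 (b) For all $t>e$, each of $\mathbb P(Y-\mu_A\ge t)$ and $\mathbb P(Y-\mu_A\le -t)$ is at most $$\exp\left(-\frac tc\left(\log t-\log\log t-\frac{\sigma_A^2}{c}\right)\right)\le \exp\left(-\frac t{2c}\left(\log t-\frac{2\sigma_A^2}{c}\right)\right).$$ -/

import Mathlib

open MeasureTheory ProbabilityTheory

noncomputable section

namespace HoeffdingStat

variable {n : ℕ}

/-- The row mean `a_{i·} = (1/n) ∑_j a_{ij}`. -/
def rowMean (a : Matrix (Fin n) (Fin n) ℝ) (i : Fin n) : ℝ :=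
  (1 / (n : ℝ)) * ∑ j, a i j

/-- The column mean `a_{·j} = (1/n) ∑_i a_{ij}`. -/
def colMean (a : Matrix (Fin n) (Fin n) ℝ) (j : Fin n) : ℝ :=
  (1 / (n : ℝ)) * ∑ i, a i j

/-- The overall mean `a_{··} = (1/n²) ∑_{i,j} a_{ij}`. -/
def grandMean (a : Matrix (Fin n) (Fin n) ℝ) : ℝ :=
  (1 / (n : ℝ) ^ 2) * ∑ i, ∑ j, a i j

/-- `μ_A = n a_{··}`. -/
def mu (a : Matrix (Fin n) (Fin n) ℝ) : ℝ :=
  (n : ℝ) * grandMean a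

/-- `σ_A² = (1/(n-1)) ∑_{i,j} (a_{ij} - a_{i·} - a_{·j} + a_{··})²`. -/
def sigmaSq (a : Matrix (Fin n) (Fin n) ℝ) : ℝ :=
  (1 / ((n : ℝ) - 1)) * ∑ i, ∑ j, (a i j - rowMean a i - colMean a j + grandMean a) ^ 2

/-- `‖a‖ = max_{i,j} |a_{ij} - a_{i·}|` (a supremum over a finite index set). -/
def rowDev (a : Matrix (Fin n) (Fin n) ℝ) : ℝ :=
  ⨆ p : Fin n × Fin n, |a p.1 p.2 - rowMean a p.1|

/-- The permutation statistic `∑_i a_{i τ(i)}` of a permutation `τ`. -/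
def stat (a : Matrix (Fin n) (Fin n) ℝ) (τ : Equiv.Perm (Fin n)) : ℝ :=
  ∑ i, a i (τ i)

end HoeffdingStat

end

/-!
After double centring, the statistic `Y = stat d τ` has mean zero and `d` has vanishing row and
column sums. For a uniform permutation `τ` and a transposition `swap i j`, the pair
`stat d τ`, `stat d (τ * swap i j)` is exchangeable and satisfies a linear regression condition, so
Stein's identity (`sum_stat_mul`) writes `𝔼[Y f(Y)]` as an average of `ΔY * Δf(Y)`. Taking `f = id`
gives the variance. Taking `f y = exp (θ * y)` gives the derivative of the moment generating
function `m`, and there `ΔY * Δf(Y)` is at most `θ * (ΔY) ^ 2` times the larger of the two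
exponentials.

The square `(ΔY) ^ 2` depends only on `i`, `j` and the values `τ i = p`, `τ j = q`. A permutation
that is uniform given these two values arises from an unconditioned uniform `σ` by two exchanges of
values (`sum_moveTo_moveTo`). These exchanges, and the transposition `swap i j`, alter `σ` at no
more than four points, hence alter the statistic by at most `c = 8 * rowDev a`
(`stat_moveTo_moveTo_le`). This decouples the square from the exponential and yields
`m' θ ≤ σ² * θ * exp (c * θ) * m θ` (`sum_stat_mul_exp_le`), so
`log (m θ) ≤ σ² / c ^ 2 * (exp x * (x - 1) + 1)` with `x = c * θ` (`sum_exp_stat_le`).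

All tail bounds are Chernoff bounds from this estimate. For the first two the exponent is bounded by
rational functions: `exp x * (x - 1) + 1` is at most `x ^ 2 / (2 * (1 - x))` for `x < 1`, and at
most `5 / 3 * x ^ 2 / (2 - x)` for `x < 2`. The third uses `x = log t - log (log t)`, for which
`exp x * (x - 1) + 1 ≤ t`.
-/

namespace HoeffdingStat

/-! ### Moving a uniform permutation to prescribed values -/

/-- The permutation obtained from `σ` by exchanging the values `σ i` and `p`; it sends `i` to `p`. -/
def moveTo {α : Type*} [DecidableEq α] (i p : α) (σ : Equiv.Perm α) : Equiv.Perm α :=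
  Equiv.swap (σ i) p * σ

section moveTo

variable {α : Type*} [DecidableEq α]

lemma moveTo_apply_self (i p : α) (σ : Equiv.Perm α) : moveTo i p σ i = p := by
  simp [moveTo]

lemma moveTo_apply_of_ne {i p k : α} {σ : Equiv.Perm α} (hk : k ≠ i) (hp : σ k ≠ p) :
    moveTo i p σ k = σ k := by
  simp only [moveTo, Equiv.Perm.mul_apply]
  exact Equiv.swap_apply_of_ne_of_ne (fun h => hk (σ.injective h)) hp

lemma moveTo_moveTo_apply_left {i j p q : α} (hij : i ≠ j) (hpq : p ≠ q) (σ : Equiv.Perm α) :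
    moveTo j q (moveTo i p σ) i = p := by
  rw [moveTo_apply_of_ne hij (by rwa [moveTo_apply_self]), moveTo_apply_self]

/-- Moving two points to two prescribed values alters `σ` at no more than four points. -/
lemma moveTo_moveTo_apply_of_ne {i j p q k : α} {σ : Equiv.Perm α} (hi : k ≠ i) (hj : k ≠ j)
    (hp : k ≠ σ.symm p) (hq : k ≠ σ.symm q) :
    moveTo j q (moveTo i p σ) k = σ k := by
  have hp' : σ k ≠ p := fun h => hp (by simp [← h])
  have hq' : σ k ≠ q := fun h => hq (by simp [← h])
  have h1 : moveTo i p σ k = σ k := moveTo_apply_of_ne hi hp'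
  rw [moveTo_apply_of_ne hj (by rwa [h1]), h1]

lemma moveTo_same_value {i j p : α} (σ : Equiv.Perm α) :
    moveTo j p (moveTo i p σ) = moveTo i p σ * Equiv.swap i j := by
  conv_lhs => rw [moveTo]
  rw [Equiv.mul_swap_eq_swap_mul, moveTo_apply_self, Equiv.swap_comm]

variable [Fintype α]

/-- If `σ` is a uniform permutation and `p` an independent uniform point, then `moveTo i p σ` is
again uniform. -/
lemma sum_sum_moveTo (i : α) (h : Equiv.Perm α → ℝ) :
    ∑ σ, ∑ p, h (moveTo i p σ) = Fintype.card α * ∑ τ, h τ := by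
  -- `(σ, p) ↦ (moveTo i p σ, σ i)` is an involution, since the old value `σ i` undoes the move
  have hinv : Function.Involutive
      (fun x : Equiv.Perm α × α => (moveTo i x.2 x.1, x.1 i)) := by
    rintro ⟨σ, p⟩
    refine Prod.ext ?_ ?_
    · simp only [moveTo, Equiv.Perm.mul_apply, Equiv.swap_apply_left]
      rw [Equiv.swap_comm, ← mul_assoc, Equiv.swap_mul_self, one_mul]
    · simp [moveTo]
  have := Equiv.sum_comp hinv.toPerm (fun x : Equiv.Perm α × α => h x.1)
  rw [Fintype.sum_prod_type, Fintype.sum_prod_type] at this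
  simp only [Function.Involutive.coe_toPerm] at this
  rw [this, Finset.mul_sum]
  simp

/-- A uniform permutation is obtained from a uniform permutation `σ` by moving `i` and `j` to the
values of an independent uniform ordered pair `p ≠ q`. -/
lemma sum_moveTo_moveTo (i j : α) (h : Equiv.Perm α → ℝ) :
    ∑ σ, ∑ p, ∑ q, (if p = q then 0 else h (moveTo j q (moveTo i p σ))) =
      Fintype.card α * (Fintype.card α - 1) * ∑ τ, h τ := by
  have hdiag : ∑ σ, ∑ p, h (moveTo j p (moveTo i p σ)) = Fintype.card α * ∑ τ, h τ := by
    simp only [moveTo_same_value]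
    rw [sum_sum_moveTo i (fun τ => h (τ * Equiv.swap i j))]
    congr 1
    exact Equiv.sum_comp (Equiv.mulRight (Equiv.swap i j)) h
  have hall : ∑ σ, ∑ p, ∑ q, h (moveTo j q (moveTo i p σ)) =
      Fintype.card α * (Fintype.card α * ∑ τ, h τ) := by
    rw [sum_sum_moveTo i (fun τ => ∑ q, h (moveTo j q τ)), sum_sum_moveTo]
  have hsplit : ∀ σ p, ∑ q, (if p = q then 0 else h (moveTo j q (moveTo i p σ))) =
      ∑ q, h (moveTo j q (moveTo i p σ)) - h (moveTo j p (moveTo i p σ)) := by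
    intro σ p
    rw [eq_sub_iff_add_eq, ← Finset.sum_ite_eq Finset.univ p
      (fun q => h (moveTo j q (moveTo i p σ))) |>.trans (if_pos (Finset.mem_univ p)),
      ← Finset.sum_add_distrib]
    refine Finset.sum_congr rfl fun q _ => ?_
    split_ifs <;> simp
  simp only [hsplit, Finset.sum_sub_distrib, hall, hdiag]
  ring

end moveTo

/-! ### The exchangeable pair -/

variable {n : ℕ}

/-- The change `a i p + a j q - a i q - a j p` of the permutation statistic when the values `p`, `q`
of the permutation at `i`, `j` are exchanged. -/
def crossDiff (a : Matrix (Fin n) (Fin n) ℝ) (i j p q : Fin n) : ℝ :=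
  a i p + a j q - a i q - a j p

/-- The doubly centred matrix `a i j - rowMean a i - colMean a j + grandMean a`. -/
noncomputable def centered (a : Matrix (Fin n) (Fin n) ℝ) : Matrix (Fin n) (Fin n) ℝ :=
  fun i j => a i j - rowMean a i - colMean a j + grandMean a

lemma stat_sub_stat_mul_swap (a : Matrix (Fin n) (Fin n) ℝ) (τ : Equiv.Perm (Fin n))
    (i j : Fin n) :
    stat a τ - stat a (τ * Equiv.swap i j) = crossDiff a i j (τ i) (τ j) := by
  rcases eq_or_ne i j with rfl | hij
  · rw [Equiv.swap_self, ← Equiv.Perm.one_def, mul_one, sub_self, crossDiff, add_sub_cancel_left,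
      sub_self]
  unfold stat crossDiff
  rw [← Finset.sum_sub_distrib, ← Finset.sum_subset (Finset.subset_univ {i, j}),
    Finset.sum_pair hij]
  · simp; ring
  · intro k _ hk
    simp only [Finset.mem_insert, Finset.mem_singleton, not_or] at hk
    simp [Equiv.swap_apply_of_ne_of_ne hk.1 hk.2]

lemma crossDiff_self (a : Matrix (Fin n) (Fin n) ℝ) (i p q : Fin n) :
    crossDiff a i i p q = 0 := by
  unfold crossDiff; ring

lemma crossDiff_same_value (a : Matrix (Fin n) (Fin n) ℝ) (i j p : Fin n) :
    crossDiff a i j p p = 0 := by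
  unfold crossDiff; ring

/-- The linearity condition of an exchangeable pair: for a matrix with vanishing row and column
sums, the total change of the statistic under all transpositions is `2 * n` times its value. -/
lemma sum_crossDiff {d : Matrix (Fin n) (Fin n) ℝ} (hr : ∀ i, ∑ j, d i j = 0)
    (τ : Equiv.Perm (Fin n)) :
    ∑ i, ∑ j, crossDiff d i j (τ i) (τ j) = 2 * n * stat d τ := by
  have h : ∀ i, ∑ j, d i (τ j) = 0 := fun i => by
    rw [Equiv.sum_comp τ (fun j => d i j), hr]
  have h' : ∑ i, ∑ j, d j (τ i) = 0 := by
    rw [Finset.sum_comm]; simp [h]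
  simp only [crossDiff, Finset.sum_sub_distrib, Finset.sum_add_distrib, h, h',
    Finset.sum_const, Finset.card_univ, Fintype.card_fin, nsmul_eq_mul, stat]
  rw [← Finset.mul_sum]
  ring

/-- Stein's identity for the exchangeable pair `τ`, `τ * swap i j`. -/
lemma sum_stat_mul {d : Matrix (Fin n) (Fin n) ℝ} (hr : ∀ i, ∑ j, d i j = 0) (f : ℝ → ℝ) :
    4 * n * ∑ τ, stat d τ * f (stat d τ) =
      ∑ i, ∑ j, ∑ τ : Equiv.Perm (Fin n), crossDiff d i j (τ i) (τ j) *
        (f (stat d τ) - f (stat d (τ * Equiv.swap i j))) := by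
  have h1 : 2 * n * ∑ τ, stat d τ * f (stat d τ) =
      ∑ i, ∑ j, ∑ τ : Equiv.Perm (Fin n), crossDiff d i j (τ i) (τ j) * f (stat d τ) := by
    have : ∀ τ : Equiv.Perm (Fin n), 2 * n * (stat d τ * f (stat d τ)) =
        ∑ i, ∑ j, crossDiff d i j (τ i) (τ j) * f (stat d τ) := by
      intro τ
      rw [← mul_assoc, ← sum_crossDiff hr]
      simp only [Finset.sum_mul]
    rw [Finset.mul_sum, Finset.sum_congr rfl fun τ _ => this τ, Finset.sum_comm]
    exact Finset.sum_congr rfl fun i _ => Finset.sum_comm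
  -- exchangeability: reindex by `τ ↦ τ * swap i j`, which reverses the sign of the difference
  have h2 : ∀ i j, ∑ τ : Equiv.Perm (Fin n), crossDiff d i j (τ i) (τ j) * f (stat d τ) =
      -∑ τ : Equiv.Perm (Fin n), crossDiff d i j (τ i) (τ j) *
        f (stat d (τ * Equiv.swap i j)) := by
    intro i j
    rw [← Equiv.sum_comp (Equiv.mulRight (Equiv.swap i j)), ← Finset.sum_neg_distrib]
    refine Finset.sum_congr rfl fun τ _ => ?_
    simp only [Equiv.coe_mulRight, Equiv.Perm.mul_apply, Equiv.swap_apply_left,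
      Equiv.swap_apply_right, crossDiff]
    ring
  simp only [mul_sub, Finset.sum_sub_distrib]
  rw [← h1]
  have h3 : ∑ i, ∑ j, ∑ τ : Equiv.Perm (Fin n), crossDiff d i j (τ i) (τ j) *
        f (stat d (τ * Equiv.swap i j)) = -(2 * n * ∑ τ, stat d τ * f (stat d τ)) := by
    rw [h1]
    simp only [h2, Finset.sum_neg_distrib, neg_neg]
  rw [h3]
  ring

lemma sum_sum_sub_sq {u : Fin n → ℝ} (hu : ∑ p, u p = 0) :
    ∑ p, ∑ q, (u p - u q) ^ 2 = 2 * n * ∑ p, u p ^ 2 := by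
  have : ∀ p q, (u p - u q) ^ 2 = u p ^ 2 + u q ^ 2 - 2 * (u p * u q) := by
    intro p q; ring
  simp only [this, Finset.sum_sub_distrib, Finset.sum_add_distrib, ← Finset.mul_sum, hu,
    Finset.sum_const, Finset.card_univ, Fintype.card_fin, nsmul_eq_mul, mul_zero, sub_zero]
  ring

/-- For a matrix with vanishing row and column sums all cross terms vanish. -/
lemma sum_crossDiff_sq {d : Matrix (Fin n) (Fin n) ℝ} (hr : ∀ i, ∑ j, d i j = 0)
    (hc : ∀ j, ∑ i, d i j = 0) :
    ∑ i, ∑ j, ∑ p, ∑ q, crossDiff d i j p q ^ 2 = 4 * n ^ 2 * ∑ i, ∑ j, d i j ^ 2 := by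
  have hpq : ∀ i j, ∑ p, ∑ q, crossDiff d i j p q ^ 2 =
      2 * n * ∑ p, (d i p - d j p) ^ 2 := by
    intro i j
    rw [← sum_sum_sub_sq (u := fun p => d i p - d j p) (by simp [hr])]
    refine Finset.sum_congr rfl fun p _ => Finset.sum_congr rfl fun q _ => ?_
    unfold crossDiff; ring
  have hij : ∑ i, ∑ j, ∑ p, (d i p - d j p) ^ 2 = 2 * n * ∑ i, ∑ j, d i j ^ 2 := by
    calc ∑ i, ∑ j, ∑ p, (d i p - d j p) ^ 2 = ∑ p, ∑ i, ∑ j, (d i p - d j p) ^ 2 := by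
          rw [Finset.sum_comm]
          rw [Finset.sum_congr rfl fun j _ => Finset.sum_comm, Finset.sum_comm]
          exact Finset.sum_congr rfl fun p _ => Finset.sum_comm
      _ = ∑ p, 2 * n * ∑ i, d i p ^ 2 :=
          Finset.sum_congr rfl fun p _ => sum_sum_sub_sq (hc p)
      _ = 2 * n * ∑ i, ∑ j, d i j ^ 2 := by rw [← Finset.mul_sum, Finset.sum_comm]
  simp only [hpq, ← Finset.mul_sum]
  rw [hij]
  ring

/-- Conditionally on `τ i = p` and `τ j = q`, the mean of `h τ` is that of `h` at the permutation
obtained from a uniform one by moving `i` to `p` and `j` to `q`. -/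
lemma sum_crossDiff_sq_mul (d : Matrix (Fin n) (Fin n) ℝ) (i j : Fin n)
    (h : Equiv.Perm (Fin n) → ℝ) :
    n * ((n : ℝ) - 1) * ∑ τ : Equiv.Perm (Fin n), crossDiff d i j (τ i) (τ j) ^ 2 * h τ =
      ∑ σ, ∑ p, ∑ q, crossDiff d i j p q ^ 2 * h (moveTo j q (moveTo i p σ)) := by
  rcases eq_or_ne i j with rfl | hij
  · simp [crossDiff_self]
  have := sum_moveTo_moveTo i j
    (fun τ : Equiv.Perm (Fin n) => crossDiff d i j (τ i) (τ j) ^ 2 * h τ)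
  rw [Fintype.card_fin] at this
  rw [← this]
  refine Finset.sum_congr rfl fun σ _ => Finset.sum_congr rfl fun p _ =>
    Finset.sum_congr rfl fun q _ => ?_
  split_ifs with hpq
  · simp [hpq, crossDiff_same_value]
  · rw [moveTo_moveTo_apply_left hij hpq, moveTo_apply_self]

/-- The second moment of the statistic of a matrix with vanishing row and column sums. -/
lemma sum_stat_sq (hn : 2 ≤ n) {d : Matrix (Fin n) (Fin n) ℝ} (hr : ∀ i, ∑ j, d i j = 0)
    (hc : ∀ j, ∑ i, d i j = 0) :
    ∑ τ, stat d τ ^ 2 = n.factorial * (1 / ((n : ℝ) - 1) * ∑ i, ∑ j, d i j ^ 2) := by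
  have hn' : (2 : ℝ) ≤ n := by exact_mod_cast hn
  have h1 := sum_stat_mul hr id
  simp only [id, ← stat_sub_stat_mul_swap d, ← sq] at h1
  simp only [stat_sub_stat_mul_swap] at h1
  have h2 : ∀ i j, n * ((n : ℝ) - 1) *
      ∑ τ : Equiv.Perm (Fin n), crossDiff d i j (τ i) (τ j) ^ 2 =
      n.factorial * ∑ p, ∑ q, crossDiff d i j p q ^ 2 := by
    intro i j
    have := sum_crossDiff_sq_mul d i j (fun _ => 1)
    simpa [Fintype.card_perm] using this
  have h3 : n * ((n : ℝ) - 1) * (4 * n * ∑ τ, stat d τ ^ 2) =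
      n.factorial * (4 * n ^ 2 * ∑ i, ∑ j, d i j ^ 2) := by
    rw [h1, ← sum_crossDiff_sq hr hc, Finset.mul_sum, Finset.mul_sum]
    refine Finset.sum_congr rfl fun i _ => ?_
    rw [Finset.mul_sum, Finset.mul_sum]
    exact Finset.sum_congr rfl fun j _ => h2 i j
  have hn1 : (n : ℝ) - 1 ≠ 0 := by linarith
  have hn0 : (n : ℝ) ≠ 0 := by linarith
  have h4 : (4 * n ^ 2 : ℝ) ≠ 0 := by positivity
  apply mul_left_cancel₀ (mul_ne_zero h4 hn1)
  have h5 : ((n : ℝ) - 1) * (1 / ((n : ℝ) - 1) * ∑ i, ∑ j, d i j ^ 2) = ∑ i, ∑ j, d i j ^ 2 := by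
    field_simp
  linear_combination h3 - 4 * n ^ 2 * n.factorial * h5

/-! ### Row and column means -/

lemma sum_rowMean (hn : n ≠ 0) (a : Matrix (Fin n) (Fin n) ℝ) :
    ∑ i, rowMean a i = n * grandMean a := by
  have : (n : ℝ) ≠ 0 := by exact_mod_cast hn
  simp only [rowMean, grandMean, ← Finset.mul_sum]
  field_simp

lemma sum_colMean (hn : n ≠ 0) (a : Matrix (Fin n) (Fin n) ℝ) :
    ∑ j, colMean a j = n * grandMean a := by
  have : (n : ℝ) ≠ 0 := by exact_mod_cast hn
  simp only [colMean, grandMean, ← Finset.mul_sum]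
  rw [Finset.sum_comm]
  field_simp

lemma sum_centered_row (hn : n ≠ 0) (a : Matrix (Fin n) (Fin n) ℝ) (i : Fin n) :
    ∑ j, centered a i j = 0 := by
  have : (n : ℝ) ≠ 0 := by exact_mod_cast hn
  simp only [centered, Finset.sum_add_distrib, Finset.sum_sub_distrib, sum_colMean hn,
    Finset.sum_const, Finset.card_univ, Fintype.card_fin, nsmul_eq_mul]
  rw [rowMean]
  field_simp
  ring

lemma sum_centered_col (hn : n ≠ 0) (a : Matrix (Fin n) (Fin n) ℝ) (j : Fin n) :
    ∑ i, centered a i j = 0 := by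
  have : (n : ℝ) ≠ 0 := by exact_mod_cast hn
  simp only [centered, Finset.sum_add_distrib, Finset.sum_sub_distrib, sum_rowMean hn,
    Finset.sum_const, Finset.card_univ, Fintype.card_fin, nsmul_eq_mul]
  rw [colMean]
  field_simp
  ring

lemma stat_centered (hn : n ≠ 0) (a : Matrix (Fin n) (Fin n) ℝ) (τ : Equiv.Perm (Fin n)) :
    stat (centered a) τ = stat a τ - mu a := by
  simp only [stat, centered, Finset.sum_add_distrib, Finset.sum_sub_distrib, sum_rowMean hn,
    Finset.sum_const, Finset.card_univ, Fintype.card_fin, nsmul_eq_mul, mu]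
  rw [Equiv.sum_comp τ (fun j => colMean a j), sum_colMean hn]
  ring

lemma stat_neg (a : Matrix (Fin n) (Fin n) ℝ) (τ : Equiv.Perm (Fin n)) :
    stat (-a) τ = -stat a τ := by
  simp [stat]

lemma rowMean_neg (a : Matrix (Fin n) (Fin n) ℝ) (i : Fin n) : rowMean (-a) i = -rowMean a i := by
  simp [rowMean]

lemma colMean_neg (a : Matrix (Fin n) (Fin n) ℝ) (i : Fin n) : colMean (-a) i = -colMean a i := by
  simp [colMean]

lemma grandMean_neg (a : Matrix (Fin n) (Fin n) ℝ) : grandMean (-a) = -grandMean a := by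
  simp [grandMean]

lemma mu_neg (a : Matrix (Fin n) (Fin n) ℝ) : mu (-a) = -mu a := by
  simp [mu, grandMean_neg]

lemma sigmaSq_neg (a : Matrix (Fin n) (Fin n) ℝ) : sigmaSq (-a) = sigmaSq a := by
  simp only [sigmaSq, rowMean_neg, colMean_neg, grandMean_neg, Matrix.neg_apply]
  congr 1
  exact Finset.sum_congr rfl fun i _ => Finset.sum_congr rfl fun j _ => by ring

lemma rowDev_neg (a : Matrix (Fin n) (Fin n) ℝ) : rowDev (-a) = rowDev a := by
  simp only [rowDev, rowMean_neg, Matrix.neg_apply]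
  congr 1
  funext p
  rw [← abs_neg]
  congr 1
  ring

lemma abs_sub_rowMean_le (a : Matrix (Fin n) (Fin n) ℝ) (i j : Fin n) :
    |a i j - rowMean a i| ≤ rowDev a :=
  le_ciSup (f := fun p : Fin n × Fin n => |a p.1 p.2 - rowMean a p.1|)
    (Set.finite_range _).bddAbove (i, j)

lemma rowDev_nonneg (a : Matrix (Fin n) (Fin n) ℝ) : 0 ≤ rowDev a :=
  Real.iSup_nonneg fun _ => abs_nonneg _

lemma sigmaSq_nonneg (hn : 1 ≤ n) (a : Matrix (Fin n) (Fin n) ℝ) : 0 ≤ sigmaSq a := by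
  have : (1 : ℝ) ≤ n := by exact_mod_cast hn
  exact mul_nonneg (one_div_nonneg.2 (by linarith))
    (Finset.sum_nonneg fun i _ => Finset.sum_nonneg fun j _ => sq_nonneg _)

/-- If every row is constant then the column means all agree with the grand mean. -/
lemma rowDev_pos (hn : n ≠ 0) {a : Matrix (Fin n) (Fin n) ℝ} (h : sigmaSq a ≠ 0) :
    0 < rowDev a := by
  refine (rowDev_nonneg a).lt_of_ne fun h0 => h ?_
  have hn' : (n : ℝ) ≠ 0 := by exact_mod_cast hn
  have hrow : ∀ i j, a i j = rowMean a i := fun i j => by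
    have := abs_sub_rowMean_le a i j
    rw [← h0] at this
    exact sub_eq_zero.1 (abs_nonpos_iff.1 this)
  have hcol : ∀ j, colMean a j = grandMean a := fun j => by
    rw [colMean, Finset.sum_congr rfl fun i _ => hrow i j, sum_rowMean hn]
    field_simp
  have : ∀ i j, a i j - rowMean a i - colMean a j + grandMean a = 0 := fun i j => by
    rw [hcol, ← hrow i j]; ring
  simp [sigmaSq, this]

/-! ### The moment generating function -/

/-- Changing a permutation at no more than four points changes the statistic by at most eight times
the largest deviation from the row means. -/
lemma abs_stat_sub_stat_le (a : Matrix (Fin n) (Fin n) ℝ) {σ τ : Equiv.Perm (Fin n)}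
    (s : Finset (Fin n)) (hs : s.card ≤ 4) (h : ∀ k ∉ s, τ k = σ k) :
    |stat a τ - stat a σ| ≤ 8 * rowDev a := by
  have h1 : stat a τ - stat a σ =
      ∑ k ∈ s, ((a k (τ k) - rowMean a k) - (a k (σ k) - rowMean a k)) := by
    rw [stat, stat, ← Finset.sum_sub_distrib, ← Finset.sum_subset (Finset.subset_univ s)]
    · exact Finset.sum_congr rfl fun k _ => by ring
    · intro k _ hk
      rw [h k hk, sub_self]
  have hs' : (s.card : ℝ) ≤ 4 := by exact_mod_cast hs
  calc |stat a τ - stat a σ|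
      ≤ ∑ k ∈ s, |(a k (τ k) - rowMean a k) - (a k (σ k) - rowMean a k)| := by
        rw [h1]; exact Finset.abs_sum_le_sum_abs _ _
    _ ≤ ∑ k ∈ s, 2 * rowDev a := Finset.sum_le_sum fun k _ => by
        refine (abs_sub _ _).trans ?_
        linarith [abs_sub_rowMean_le a k (τ k), abs_sub_rowMean_le a k (σ k)]
    _ ≤ 8 * rowDev a := by
        rw [Finset.sum_const, nsmul_eq_mul]
        nlinarith [rowDev_nonneg a]

lemma stat_moveTo_moveTo_le (a : Matrix (Fin n) (Fin n) ℝ) (σ : Equiv.Perm (Fin n))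
    (i j p q : Fin n) :
    stat a (moveTo j q (moveTo i p σ)) ≤ stat a σ + 8 * rowDev a ∧
      stat a (moveTo j q (moveTo i p σ) * Equiv.swap i j) ≤ stat a σ + 8 * rowDev a := by
  have key : ∀ k ∉ ({i, j, σ.symm p, σ.symm q} : Finset (Fin n)),
      moveTo j q (moveTo i p σ) k = σ k := by
    intro k hk
    simp only [Finset.mem_insert, Finset.mem_singleton, not_or] at hk
    exact moveTo_moveTo_apply_of_ne hk.1 hk.2.1 hk.2.2.1 hk.2.2.2
  constructor
  · linarith [(abs_le.1 (abs_stat_sub_stat_le a _ Finset.card_le_four key)).2]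
  · have key' : ∀ k ∉ ({i, j, σ.symm p, σ.symm q} : Finset (Fin n)),
        (moveTo j q (moveTo i p σ) * Equiv.swap i j) k = σ k := by
      intro k hk
      rw [← key k hk, Equiv.Perm.mul_apply]
      simp only [Finset.mem_insert, Finset.mem_singleton, not_or] at hk
      rw [Equiv.swap_apply_of_ne_of_ne hk.1 hk.2.1]
    linarith [(abs_le.1 (abs_stat_sub_stat_le a _ Finset.card_le_four key')).2]

lemma sub_mul_exp_sub_exp_le {x y θ B : ℝ} (hθ : 0 ≤ θ) (hx : Real.exp (θ * x) ≤ B)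
    (hy : Real.exp (θ * y) ≤ B) :
    (x - y) * (Real.exp (θ * x) - Real.exp (θ * y)) ≤ θ * ((x - y) ^ 2 * B) := by
  wlog h : y ≤ x generalizing x y
  · have := this hy hx (le_of_not_ge h)
    linarith [show (y - x) ^ 2 = (x - y) ^ 2 by ring]
  have h1 : Real.exp (θ * x) - Real.exp (θ * y) ≤ θ * (x - y) * Real.exp (θ * x) := by
    have : Real.exp (θ * y) = Real.exp (θ * x) * Real.exp (-(θ * (x - y))) := by
      rw [← Real.exp_add]; congr 1; ring
    rw [this]
    nlinarith [Real.add_one_le_exp (-(θ * (x - y))), Real.exp_pos (θ * x)]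
  have hxy : 0 ≤ x - y := sub_nonneg.2 h
  calc (x - y) * (Real.exp (θ * x) - Real.exp (θ * y))
      ≤ (x - y) * (θ * (x - y) * Real.exp (θ * x)) := mul_le_mul_of_nonneg_left h1 hxy
    _ ≤ (x - y) * (θ * (x - y) * B) := by gcongr
    _ = θ * ((x - y) ^ 2 * B) := by ring

/-- The differential inequality for the moment generating function: Stein's identity expresses the
derivative by the exchangeable pair, and coupling the pair to a uniform permutation `σ` within
distance `8 * rowDev a` bounds it by the moment generating function itself. -/
lemma sum_stat_mul_exp_le (hn : 2 ≤ n) (a : Matrix (Fin n) (Fin n) ℝ) {θ : ℝ} (hθ : 0 ≤ θ) :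
    ∑ τ, (stat a τ - mu a) * Real.exp (θ * (stat a τ - mu a)) ≤
      sigmaSq a * (θ * Real.exp (8 * rowDev a * θ)) *
        ∑ τ, Real.exp (θ * (stat a τ - mu a)) := by
  have hn0 : n ≠ 0 := by omega
  have hn' : (2 : ℝ) ≤ n := by exact_mod_cast hn
  simp only [← stat_centered hn0]
  set d := centered a with hd
  set m := ∑ τ, Real.exp (θ * stat d τ) with hm
  set C := Real.exp (8 * rowDev a * θ) with hC
  -- `E τ` dominates the exponential at both members of the pair
  set E : Fin n → Fin n → Equiv.Perm (Fin n) → ℝ := fun i j τ =>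
    max (Real.exp (θ * stat d τ)) (Real.exp (θ * stat d (τ * Equiv.swap i j))) with hE
  have hEle : ∀ i j p q σ, E i j (moveTo j q (moveTo i p σ)) ≤ C * Real.exp (θ * stat d σ) := by
    intro i j p q σ
    obtain ⟨h1, h2⟩ := stat_moveTo_moveTo_le a σ i j p q
    rw [hC, ← Real.exp_add]
    refine max_le (Real.exp_le_exp.2 ?_) (Real.exp_le_exp.2 ?_) <;>
    · simp only [hd, stat_centered hn0]
      nlinarith
  have hpair : ∀ i j, n * ((n : ℝ) - 1) * ∑ τ : Equiv.Perm (Fin n), crossDiff d i j (τ i) (τ j) *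
      (Real.exp (θ * stat d τ) - Real.exp (θ * stat d (τ * Equiv.swap i j))) ≤
      θ * C * m * ∑ p, ∑ q, crossDiff d i j p q ^ 2 := by
    intro i j
    calc _ ≤ n * ((n : ℝ) - 1) * ∑ τ : Equiv.Perm (Fin n),
            θ * (crossDiff d i j (τ i) (τ j) ^ 2 * E i j τ) := by
          refine mul_le_mul_of_nonneg_left (Finset.sum_le_sum fun τ _ => ?_)
            (mul_nonneg (by linarith) (by linarith))
          rw [← stat_sub_stat_mul_swap]
          exact sub_mul_exp_sub_exp_le hθ (le_max_left _ _) (le_max_right _ _)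
      _ = θ * ∑ σ, ∑ p, ∑ q,
            crossDiff d i j p q ^ 2 * E i j (moveTo j q (moveTo i p σ)) := by
          rw [← sum_crossDiff_sq_mul, ← Finset.mul_sum]; ring
      _ ≤ θ * ∑ σ, ∑ p, ∑ q, crossDiff d i j p q ^ 2 * (C * Real.exp (θ * stat d σ)) := by
          gcongr with σ _ p _ q _
          exact hEle i j p q σ
      _ = θ * C * m * ∑ p, ∑ q, crossDiff d i j p q ^ 2 := by
          simp only [← Finset.sum_mul]
          rw [← Finset.mul_sum, ← Finset.mul_sum, ← hm]
          ring
  have hsum : n * ((n : ℝ) - 1) * (4 * n * ∑ τ, stat d τ * Real.exp (θ * stat d τ)) ≤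
      θ * C * m * (4 * n ^ 2 * ∑ i, ∑ j, d i j ^ 2) := by
    rw [sum_stat_mul (sum_centered_row hn0 a) (fun x => Real.exp (θ * x)),
      ← sum_crossDiff_sq (sum_centered_row hn0 a) (sum_centered_col hn0 a), Finset.mul_sum,
      Finset.mul_sum]
    refine Finset.sum_le_sum fun i _ => ?_
    rw [Finset.mul_sum, Finset.mul_sum]
    exact Finset.sum_le_sum fun j _ => hpair i j
  have hsig : ((n : ℝ) - 1) * sigmaSq a = ∑ i, ∑ j, d i j ^ 2 := by
    have : (n : ℝ) - 1 ≠ 0 := by linarith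
    rw [sigmaSq, ← mul_assoc, mul_one_div_cancel this, one_mul]
    rfl
  rw [← hsig] at hsum
  have hpos : 0 < 4 * (n : ℝ) ^ 2 * (n - 1) := mul_pos (by positivity) (by linarith)
  refine le_of_mul_le_mul_left ?_ hpos
  linarith

/-- Integrating the differential inequality; `x * exp x` has the primitive
`exp x * (x - 1)`. -/
lemma sum_exp_stat_le (hn : 2 ≤ n) {a : Matrix (Fin n) (Fin n) ℝ} {c : ℝ}
    (hc : c = 8 * rowDev a) (hc0 : 0 < c) {θ : ℝ} (hθ : 0 ≤ θ) :
    ∑ τ, Real.exp (θ * (stat a τ - mu a)) ≤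
      n.factorial * Real.exp (sigmaSq a / c ^ 2 * (Real.exp (c * θ) * (c * θ - 1) + 1)) := by
  set m : ℝ → ℝ := fun θ => ∑ τ, Real.exp (θ * (stat a τ - mu a)) with hm
  set G : ℝ → ℝ := fun θ =>
    sigmaSq a / c ^ 2 * (Real.exp (c * θ) * (c * θ - 1) + 1) with hG
  have hm' : ∀ s, HasDerivAt m
      (∑ τ, (stat a τ - mu a) * Real.exp (s * (stat a τ - mu a))) s := by
    intro s
    refine HasDerivAt.fun_sum fun τ _ => ?_
    have := ((hasDerivAt_id s).mul_const (stat a τ - mu a)).exp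
    simpa [mul_comm] using this
  have hG' : ∀ s, HasDerivAt G (sigmaSq a * (s * Real.exp (c * s))) s := by
    intro s
    have h1 : HasDerivAt (fun s => c * s) c s := by
      simpa using (hasDerivAt_id s).const_mul c
    have h2 := ((h1.exp.mul (h1.sub_const 1)).add_const 1).const_mul (sigmaSq a / c ^ 2)
    refine h2.congr_deriv ?_
    field_simp
    ring
  have hF' : ∀ s, HasDerivAt (fun s => m s * Real.exp (-G s)) _ s := fun s =>
    (hm' s).mul (hG' s).neg.exp
  have hanti : AntitoneOn (fun s => m s * Real.exp (-G s)) (Set.Ici 0) := by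
    refine antitoneOn_of_deriv_nonpos (convex_Ici 0)
      (fun s _ => (hF' s).continuousAt.continuousWithinAt)
      (fun s _ => (hF' s).differentiableAt.differentiableWithinAt) fun s hs => ?_
    rw [interior_Ici] at hs
    rw [(hF' s).deriv]
    have := sum_stat_mul_exp_le hn a (le_of_lt hs)
    rw [← hc] at this
    have h3 := mul_le_mul_of_nonneg_right this (Real.exp_pos (-G s)).le
    simp only [hm, Pi.neg_apply]
    linarith
  have h0 := hanti (Set.mem_Ici.2 le_rfl) (Set.mem_Ici.2 hθ) hθ
  have hG0 : G 0 = 0 := by simp [hG]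
  have hm0 : m 0 = n.factorial := by simp [hm, Fintype.card_perm]
  simp only [hG0, hm0, neg_zero, Real.exp_zero, mul_one] at h0
  rwa [Real.exp_neg, ← div_eq_mul_inv, div_le_iff₀ (Real.exp_pos _)] at h0

/-! ### Bounds for the exponent -/

lemma exp_mul_sub_one_add_one_le {x : ℝ} (hx : 0 ≤ x) (hx1 : x ≤ 1) :
    Real.exp x * (x - 1) + 1 ≤ x ^ 2 * (1 + x) / 2 := by
  nlinarith [Real.quadratic_le_exp_of_nonneg hx]

lemma exp_mul_sub_one_add_one_le_of_lt_one {x : ℝ} (hx : 0 ≤ x) (hx1 : x < 1) :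
    Real.exp x * (x - 1) + 1 ≤ x ^ 2 / (2 * (1 - x)) := by
  refine (exp_mul_sub_one_add_one_le hx hx1.le).trans ?_
  rw [le_div_iff₀ (by linarith)]
  nlinarith [pow_nonneg hx 4]

lemma exp_mul_sub_one_add_one_le_of_lt_two {x : ℝ} (hx : 0 ≤ x) (hx2 : x < 2) :
    Real.exp x * (x - 1) + 1 ≤ 5 / 3 * x ^ 2 / (2 - x) := by
  have h2x : 0 < 2 - x := by linarith
  rcases le_total x 1 with hx1 | hx1
  · refine (exp_mul_sub_one_add_one_le hx hx1).trans ?_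
    rw [le_div_iff₀ h2x]
    nlinarith [mul_nonneg (sq_nonneg x) (sq_nonneg (x - 1 / 2)), sq_nonneg x]
  · have hexp : Real.exp x ≤ (2 + x) / (2 - x) := by
      have h := Real.le_log_one_add_of_nonneg (x := 2 * x / (2 - x)) (by positivity)
      rw [show 2 * (2 * x / (2 - x)) / (2 * x / (2 - x) + 2) = x by field_simp; ring,
        show 1 + 2 * x / (2 - x) = (2 + x) / (2 - x) by field_simp; ring] at h
      exact (Real.le_log_iff_exp_le (by positivity)).1 h
    calc Real.exp x * (x - 1) + 1 ≤ (2 + x) / (2 - x) * (x - 1) + 1 := by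
          gcongr
      _ = x ^ 2 / (2 - x) := by field_simp; ring
      _ ≤ 5 / 3 * x ^ 2 / (2 - x) := by gcongr; nlinarith [sq_nonneg x]

lemma two_mul_log_log_le {t : ℝ} (ht : Real.exp 1 < t) :
    2 * Real.log (Real.log t) ≤ Real.log t := by
  have ht0 : 0 < t := (Real.exp_pos 1).trans ht
  have hL : 1 < Real.log t := (Real.lt_log_iff_exp_lt ht0).2 ht
  have h := Real.log_le_sub_one_of_pos (x := Real.log t / 2) (by linarith)
  rw [Real.log_div (by linarith) two_ne_zero] at h
  linarith [Real.log_two_lt_d9]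

/-! ### Expectations and tails under the uniform law -/

section law

variable {Ω : Type*} [MeasurableSpace Ω] {P : Measure Ω}
  [MeasurableSpace (Equiv.Perm (Fin n))] [DiscreteMeasurableSpace (Equiv.Perm (Fin n))]
  {π : Ω → Equiv.Perm (Fin n)}

lemma integral_uniform_perm
    (hπ : HasLaw π (PMF.uniformOfFintype (Equiv.Perm (Fin n))).toMeasure P)
    (f : Equiv.Perm (Fin n) → ℝ) :
    ∫ ω, f (π ω) ∂P = (n.factorial : ℝ)⁻¹ * ∑ τ, f τ := by
  have h := hπ.integral_comp (f := f) (Measurable.of_discrete.aestronglyMeasurable)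
  rw [Function.comp_def] at h
  rw [h, PMF.integral_eq_sum, Finset.mul_sum]
  simp [Fintype.card_perm]

lemma integrable_comp_perm [IsFiniteMeasure P]
    (hπ : HasLaw π (PMF.uniformOfFintype (Equiv.Perm (Fin n))).toMeasure P)
    (f : Equiv.Perm (Fin n) → ℝ) : Integrable (fun ω => f (π ω)) P := by
  refine Integrable.of_bound ((Measurable.of_discrete (f := f)).comp_aemeasurable
    hπ.aemeasurable).aestronglyMeasurable (∑ τ, ‖f τ‖) (Filter.Eventually.of_forall fun ω => ?_)
  exact Finset.single_le_sum (f := fun τ => ‖f τ‖) (fun τ _ => norm_nonneg _)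
    (Finset.mem_univ (π ω))

lemma integral_stat (hn : n ≠ 0)
    (hπ : HasLaw π (PMF.uniformOfFintype (Equiv.Perm (Fin n))).toMeasure P)
    (a : Matrix (Fin n) (Fin n) ℝ) : ∫ ω, stat a (π ω) ∂P = mu a := by
  have hn' : (4 * n : ℝ) ≠ 0 := by positivity
  have hfac : (n.factorial : ℝ) ≠ 0 := by positivity
  -- Stein's identity for a constant function says that the centred statistic has mean zero
  have h := sum_stat_mul (sum_centered_row hn a) (fun _ => 1)
  simp only [sub_self, mul_zero, mul_one, Finset.sum_const_zero, mul_eq_zero, hn', false_or,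
    stat_centered hn, Finset.sum_sub_distrib] at h
  rw [integral_uniform_perm hπ, sub_eq_zero.1 h]
  simp [Fintype.card_perm, hfac]

lemma variance_stat (hn : 2 ≤ n)
    (hπ : HasLaw π (PMF.uniformOfFintype (Equiv.Perm (Fin n))).toMeasure P)
    (a : Matrix (Fin n) (Fin n) ℝ) : variance (fun ω => stat a (π ω)) P = sigmaSq a := by
  have hn0 : n ≠ 0 := by omega
  have hfac : (n.factorial : ℝ) ≠ 0 := by positivity
  have hmeas : AEMeasurable (fun ω => stat a (π ω)) P :=
    (Measurable.of_discrete (f := stat a)).comp_aemeasurable hπ.aemeasurable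
  rw [variance_eq_integral hmeas, integral_stat hn0 hπ,
    integral_uniform_perm hπ (fun τ => (stat a τ - mu a) ^ 2)]
  simp only [← stat_centered hn0]
  rw [sum_stat_sq hn (sum_centered_row hn0 a) (sum_centered_col hn0 a),
    inv_mul_cancel_left₀ hfac]
  rfl

/-- The Chernoff bound, with the parameter of the moment generating function written `x / c`. -/
lemma measure_le_stat_sub_mu_le [IsFiniteMeasure P] (hn : 2 ≤ n)
    (hπ : HasLaw π (PMF.uniformOfFintype (Equiv.Perm (Fin n))).toMeasure P)
    {a : Matrix (Fin n) (Fin n) ℝ} {c : ℝ} (hc : c = 8 * rowDev a) (hc0 : 0 < c)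
    {x : ℝ} (hx : 0 ≤ x) (t : ℝ) :
    P.real {ω | t ≤ stat a (π ω) - mu a} ≤
      Real.exp (sigmaSq a / c ^ 2 * (Real.exp x * (x - 1) + 1) - x * t / c) := by
  have hθ : 0 ≤ x / c := div_nonneg hx hc0.le
  refine (measure_ge_le_exp_mul_mgf t hθ (integrable_comp_perm hπ
    (fun τ => Real.exp (x / c * (stat a τ - mu a))))).trans ?_
  have hfac : (0 : ℝ) < n.factorial := by positivity
  have hmgf : mgf (fun ω => stat a (π ω) - mu a) P (x / c) ≤
      Real.exp (sigmaSq a / c ^ 2 * (Real.exp x * (x - 1) + 1)) := by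
    rw [mgf, integral_uniform_perm hπ (fun τ => Real.exp (x / c * (stat a τ - mu a))),
      inv_mul_le_iff₀ hfac]
    have := sum_exp_stat_le hn hc hc0 hθ
    rwa [mul_div_cancel₀ x hc0.ne'] at this
  calc _ ≤ Real.exp (-(x / c) * t) *
        Real.exp (sigmaSq a / c ^ 2 * (Real.exp x * (x - 1) + 1)) := by gcongr
    _ = _ := by rw [← Real.exp_add]; congr 1; ring

/-- The upper tail bounds; the lower tail is the upper tail for the matrix `-a`. -/
lemma upper_tail_bounds [IsFiniteMeasure P] (hn : 2 ≤ n)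
    (hπ : HasLaw π (PMF.uniformOfFintype (Equiv.Perm (Fin n))).toMeasure P)
    {a : Matrix (Fin n) (Fin n) ℝ} {v c : ℝ} (hv : v = sigmaSq a) (hc : c = 8 * rowDev a)
    (hv0 : 0 < v) (hc0 : 0 < c) {t : ℝ} (ht : 0 ≤ t) :
    P.real {ω | t ≤ stat a (π ω) - mu a} ≤ Real.exp (-(t ^ 2 / (2 * (v + c * t)))) ∧
    P.real {ω | t ≤ stat a (π ω) - mu a} ≤ Real.exp (-(t ^ 2 / (10 * v / 3 + c * t))) ∧
    (Real.exp 1 < t → P.real {ω | t ≤ stat a (π ω) - mu a} ≤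
      Real.exp (-(t / c) * (Real.log t - Real.log (Real.log t) - v / c))) := by
  have hct : 0 ≤ c * t := mul_nonneg hc0.le ht
  refine ⟨?_, ?_, fun hte => ?_⟩
  · have hD : 0 < v + c * t := by linarith
    set x := c * t / (v + c * t) with hx
    have hx0 : 0 ≤ x := by positivity
    have hx1 : 1 - x = v / (v + c * t) := by rw [hx]; field_simp; ring
    have hx1' : x < 1 := by linarith [div_pos hv0 hD]
    refine (measure_le_stat_sub_mu_le hn hπ hc hc0 hx0 t).trans (Real.exp_le_exp.2 ?_)
    rw [← hv]
    calc _ ≤ v / c ^ 2 * (x ^ 2 / (2 * (1 - x))) - x * t / c := by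
          gcongr; exact exp_mul_sub_one_add_one_le_of_lt_one hx0 hx1'
      _ = _ := by rw [hx1, hx]; field_simp; ring
  · have hD : 0 < 10 * v / 3 + c * t := by linarith
    set D := 10 * v / 3 + c * t with hDdef
    set x := 2 * (c * t) / D with hx
    have hx0 : 0 ≤ x := by positivity
    have hx1 : 2 - x = 20 * v / (3 * D) := by rw [hx]; field_simp; rw [hDdef]; ring
    have hx1' : x < 2 := by
      have : 0 < 20 * v / (3 * D) := by positivity
      linarith
    refine (measure_le_stat_sub_mu_le hn hπ hc hc0 hx0 t).trans (Real.exp_le_exp.2 ?_)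
    rw [← hv]
    calc _ ≤ v / c ^ 2 * (5 / 3 * x ^ 2 / (2 - x)) - x * t / c := by
          gcongr; exact exp_mul_sub_one_add_one_le_of_lt_two hx0 hx1'
      _ = _ := by rw [hx1, hx]; field_simp; ring
  · have ht0 : 0 < t := (Real.exp_pos 1).trans hte
    have hL : 1 < Real.log t := (Real.lt_log_iff_exp_lt ht0).2 hte
    have hLL : 0 < Real.log (Real.log t) := Real.log_pos hL
    -- this choice makes `exp x = t / log t`
    set x := Real.log t - Real.log (Real.log t) with hx
    have hexp : Real.exp x = t / Real.log t := by
      rw [hx, Real.exp_sub, Real.exp_log ht0, Real.exp_log (by linarith)]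
    have hx0 : 0 ≤ x := by linarith [two_mul_log_log_le hte]
    refine (measure_le_stat_sub_mu_le hn hπ hc hc0 hx0 t).trans (Real.exp_le_exp.2 ?_)
    rw [← hv]
    have h1 : 1 ≤ t / Real.log t :=
      (one_le_div (by linarith)).2 (Real.log_le_self ht)
    have h2 : t / Real.log t * Real.log t = t := div_mul_cancel₀ _ (by linarith)
    have h3 : Real.exp x * (x - 1) + 1 ≤ t := by
      rw [hexp, hx]
      nlinarith [mul_nonneg (zero_le_one.trans h1) hLL.le]
    calc _ ≤ v / c ^ 2 * t - x * t / c := by gcongr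
      _ = _ := by field_simp; ring

end law

end HoeffdingStat


theorem theorem3p1 {Ω : Type*} [MeasurableSpace Ω] (P : Measure Ω) [IsProbabilityMeasure P]
    (n : ℕ) (hn : 3 ≤ n)
    [MeasurableSpace (Equiv.Perm (Fin n))] [DiscreteMeasurableSpace (Equiv.Perm (Fin n))]
    (π : Ω → Equiv.Perm (Fin n))
    (hπ : HasLaw π (PMF.uniformOfFintype (Equiv.Perm (Fin n))).toMeasure P)
    (a : Matrix (Fin n) (Fin n) ℝ)
    (Y : Ω → ℝ) (hY : ∀ ω, Y ω = HoeffdingStat.stat a (π ω))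
    (μ v c : ℝ) (hμ : μ = HoeffdingStat.mu a) (hv : v = HoeffdingStat.sigmaSq a)
    (hc : c = 8 * HoeffdingStat.rowDev a) (hv0 : v ≠ 0) :
    -- `μ` and `v` are the mean and the variance of `Y`, and `c` is a positive constant
    (∫ ω, Y ω ∂P = μ ∧ variance Y P = v ∧ 0 < v ∧ 0 < c) ∧
    -- part (a)
    (∀ t : ℝ, 0 ≤ t →
      P.real {ω | t ≤ Y ω - μ} ≤ Real.exp (-(t ^ 2 / (2 * (v + c * t)))) ∧
      P.real {ω | Y ω - μ ≤ -t} ≤ Real.exp (-(t ^ 2 / (2 * (v + c * t)))) ∧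
      P.real {ω | t ≤ Y ω - μ} ≤ Real.exp (-(t ^ 2 / (10 * v / 3 + c * t))) ∧
      P.real {ω | Y ω - μ ≤ -t} ≤ Real.exp (-(t ^ 2 / (10 * v / 3 + c * t)))) ∧
    -- part (b)
    (∀ t : ℝ, Real.exp 1 < t →
      P.real {ω | t ≤ Y ω - μ} ≤
        Real.exp (-(t / c) * (Real.log t - Real.log (Real.log t) - v / c)) ∧
      P.real {ω | Y ω - μ ≤ -t} ≤
        Real.exp (-(t / c) * (Real.log t - Real.log (Real.log t) - v / c)) ∧
      Real.exp (-(t / c) * (Real.log t - Real.log (Real.log t) - v / c)) ≤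
        Real.exp (-(t / (2 * c)) * (Real.log t - 2 * v / c))) := by
  open HoeffdingStat in
  obtain rfl : Y = fun ω => stat a (π ω) := funext hY
  have hn0 : n ≠ 0 := by omega
  have hn2 : 2 ≤ n := by omega
  have hvpos : 0 < v := hv0.symm.lt_of_le (hv ▸ sigmaSq_nonneg (by omega) a)
  have hcpos : 0 < c := by
    have := rowDev_pos hn0 (hv ▸ hv0)
    linarith
  have hlow : ∀ t, {ω | stat a (π ω) - μ ≤ -t} = {ω | t ≤ stat (-a) (π ω) - mu (-a)} := by
    intro t
    ext ω
    simp only [Set.mem_ofPred_eq, stat_neg, mu_neg, hμ]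
    constructor <;> intro h <;> linarith
  have up : ∀ t : ℝ, 0 ≤ t → _ := fun t ht => upper_tail_bounds hn2 hπ hv hc hvpos hcpos ht
  have low : ∀ t : ℝ, 0 ≤ t → _ := fun t ht =>
    upper_tail_bounds hn2 hπ (a := -a) (by rw [sigmaSq_neg, hv]) (by rw [rowDev_neg, hc])
      hvpos hcpos ht
  simp only [← hlow] at low
  rw [← hμ] at up
  refine ⟨⟨hμ ▸ integral_stat hn0 hπ a, hv ▸ variance_stat hn2 hπ a, hvpos, hcpos⟩,
    fun t ht => ⟨(up t ht).1, (low t ht).1, (up t ht).2.1, (low t ht).2.1⟩, fun t ht => ?_⟩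
  have ht0 : 0 < t := (Real.exp_pos 1).trans ht
  refine ⟨(up t ht0.le).2.2 ht, (low t ht0.le).2.2 ht, Real.exp_le_exp.2 ?_⟩
  have h1 : 0 ≤ t / c * (Real.log t / 2 - Real.log (Real.log t)) :=
    mul_nonneg (by positivity) (by linarith [two_mul_log_log_le ht])
  have h2 : -(t / (2 * c)) * (Real.log t - 2 * v / c) = -(t / c) * (Real.log t / 2 - v / c) := by
    field_simp
  rw [h2]
  linarith
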